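/- **Theorem 2.6.** Words are over a fixed alphabet $\mathcal A$. A finite word is *square-free* if it is not of the form $PXXS$ with $X$ nonempty; a doubly infinite word $W=\cdots w_{-1}w_0w_1\cdots$ is square-free if all its finite factors are. The *extension* of $W$ at position $i\in\mathbb Z$ by a letter $x$ is $\cdots w_{i-2}w_{i-1}\,x\,w_iw_{i+1}\cdots$, with $x$ at index $i$ and each $w_j$, $j\ge i$, moved to index $j+1$. A doubly infinite word is *bifurcate* if it is square-free and has, at every position $i\in\mathbb Z$, at least one square-free extension by a letter of $\mathcal A$. A *complete bifurcate tree* of doubly infinite words over $\mathcal A$ is a rooted tree whose vertices are labelled by bifurcate doubly infinite words over $\mathcal A$ (different vertices may carry the same word), such that each child of a vertex labelled $W$ is labelled by an extension of $W$ at some position, different children of a vertex being assigned different positions, and every position $i\in\mathbb Z$ being assigned to a child. Let $D$ be the graph on the dyadic rationals of $[0,1]$ in which, for every $n\ge 0$ and $0\le a<2^n$, the numbers $a/2^n$ and $(a+1)/2^n$ are adjacent (and there are no other edges), and let $G$ be the graph on the dyadic rationals that is the union over all $m\in\mathbb Z$ of the copies $m+D$ of $D$ placed on $[m,m+1]$.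 A vertex coloring of a graph is *square-free* (nonrepetitive) if the word of colors along every finite simple path is square-free. Then there exists a complete bifurcate tree of doubly infinite words over an alphabet of size $12$. Moreover, it can be obtained from a coloring of $G$: there are a square-free coloring $c$ of $G$ with colors in a $12$-element set $\mathcal A$ and a complete bifurcate tree of doubly infinite words over $\mathcal A$ whose root is $\cdots c(-1)c(0)c(1)c(2)\cdots$ (the letter at index $n$ is $c(n)$) and each of whose words is $\cdots c(p_{-1})c(p_0)c(p_1)\cdots$ for some doubly infinite path $(p_i)_{i\in\mathbb Z}$ of $G$ with $p_i<p_{i+1}$ for all $i$. -/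

import Mathlib

/-- A finite word is square-free if it is not of the form `P X X S` with `X` nonempty. -/
def WordSquareFree {A : Type*} (W : List A) : Prop :=
  ¬ ∃ P X S : List A, X ≠ [] ∧ W = P ++ X ++ X ++ S

/-- The factor of length `n` of a doubly infinite word that starts at index `i`. -/
def factorAt {A : Type*} (W : ℤ → A) (i : ℤ) (n : ℕ) : List A :=
  (List.range n).map fun k : ℕ => W (i + (k : ℤ))

/-- A doubly infinite word is square-free if all its finite factors are square-free. -/
def BiSquareFree {A : Type*} (W : ℤ → A) : Prop :=
  ∀ (i : ℤ) (n : ℕ), WordSquareFree (factorAt W i n)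

/-- The single-letter extension of a doubly infinite word at position `i`: the letter `x` is
inserted between the letters `W (i - 1)` and `W i`, and the letters `W i, W (i + 1), …` move one
index to the right. -/
def extendAt {A : Type*} (W : ℤ → A) (i : ℤ) (x : A) : ℤ → A :=
  fun j => if j < i then W j else if j = i then x else W (j - 1)

/-- A doubly infinite word is bifurcate over the alphabet `A` if it is square-free and has a
square-free single-letter extension at every position. -/
def BiBifurcate {A : Type*} (W : ℤ → A) : Prop :=
  BiSquareFree W ∧ ∀ i : ℤ, ∃ x : A, BiSquareFree (extendAt W i x)

/-- A complete bifurcate tree of doubly infinite words over the alphabet `A`. Each vertex `v` of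
the rooted tree `T` carries a bifurcate word `word v`. In `T`, `u ⋖ v` says that `v` is a child
(an immediate descendant) of `u`; then `word v` is a single-letter extension of `word u` at the
position `pos v`. Different children of `u` belong to different positions, and every position
occurs. (The value of `pos` at the root plays no role.) -/
structure IsCompleteBifurcateTree {A : Type*} (T : RootedTree)
    (word : T → ℤ → A) (pos : T → ℤ) : Prop where
  bifurcate : ∀ v : T, BiBifurcate (word v)
  extension : ∀ u v : T, u ⋖ v → ∃ x : A, word v = extendAt (word u) (pos v) x
  pos_injective : ∀ u v w : T, u ⋖ v → u ⋖ w → pos v = pos w → v = w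
  pos_surjective : ∀ (u : T) (i : ℤ), ∃ v : T, u ⋖ v ∧ pos v = i

/-- The dyadic rationals. -/
def DyadicRat : Type :=
  {q : ℚ // ∃ (a : ℤ) (n : ℕ), q = (a : ℚ) / 2 ^ n}

/-- `x < y` are joined by an edge of the dyadic graph `D` on `[0, 1]`: for some `n` they are
consecutive elements `a / 2 ^ n`, `(a + 1) / 2 ^ n` of `{0, 1 / 2 ^ n, …, (2 ^ n - 1) / 2 ^ n, 1}`. -/
def DyadicEdge (x y : ℚ) : Prop :=
  ∃ n a : ℕ, a < 2 ^ n ∧ x = (a : ℚ) / 2 ^ n ∧ y = ((a : ℚ) + 1) / 2 ^ n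

/-- The graph on the dyadic rationals that is the union, over all integers `m`, of the copies of
the dyadic graph `D` placed on the intervals `[m, m + 1]`. -/
def lineDyadicGraph : SimpleGraph DyadicRat :=
  SimpleGraph.fromRel fun x y => ∃ m : ℤ, DyadicEdge (x.1 - m) (y.1 - m)

/-- A square-free (nonrepetitive) vertex coloring: the word of colors along every simple path is
square-free. -/
def IsSquareFreeColoring {V C : Type*} (G : SimpleGraph V) (c : V → C) : Prop :=
  ∀ (u v : V) (p : G.Walk u v), p.IsPath → WordSquareFree (p.support.map c)

/-- A doubly infinite path of `lineDyadicGraph` that always goes to the right. -/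
def IsRightwardPath (p : ℤ → DyadicRat) : Prop :=
  ∀ i : ℤ, (p i).1 < (p (i + 1)).1 ∧ lineDyadicGraph.Adj (p i) (p (i + 1))

/-! Give each vertex of $G$ a level, its distance from the integers. The vertices of level $k+1$
under an edge whose two ends have level $k$ form a doubly infinite path, which supplies an index; on
level 0 the index is the integer itself. Color a vertex by $(f(\text{level}), g(\text{index}))$,
where $g$ is square-free over 3 letters and $f$ is square-free over 4 letters without palindromes of
length three. This uses $4\cdot 3=12$ colors.

Suppose a simple path has color word $XX$. Levels change by at most 1 along an edge, so they form a
lazy walk on which $f$ reads a square; `lazyWalk_boring` then says that both halves have the same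
levels. Take the lowest level $k$. Edges do not cross, so between visits to level $k$ the path makes
excursions under single edges of level $k$, and the level-$k$ vertices themselves form a simple path
(`isChain_filter_level`). Their indices run monotonically with step $\pm1$, so $g$ would contain a
square.

The tree comes from subdivision: vertices are finite sequences of positions, and each position
inserts the midpoint of an edge into a rightward path that starts as the integers. Every resulting
path is simple on finite windows, so its color word is square-free, and inserting a midpoint is a
one-letter extension. -/

/-! ### The Thue–Morse word and overlap-freeness -/

/-- The Thue–Morse word: the parity of the sum of the binary digits. -/
def thueMorse : ℕ → Bool
  | 0 => false
  | n + 1 => xor (thueMorse ((n + 1) / 2)) (decide ((n + 1) % 2 = 1))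

theorem thueMorse_two_mul (n : ℕ) : thueMorse (2 * n) = thueMorse n := by
  rcases n with _ | n
  · rfl
  · rw [show 2 * (n + 1) = 2 * n + 1 + 1 by ring, thueMorse,
      show (2 * n + 1 + 1) / 2 = n + 1 by omega, show (2 * n + 1 + 1) % 2 = 0 by omega]
    simp

theorem thueMorse_two_mul_add_one (n : ℕ) : thueMorse (2 * n + 1) = !thueMorse n := by
  rw [thueMorse, show (2 * n + 1) / 2 = n by omega, show (2 * n + 1) % 2 = 1 by omega]
  simp

/-- The letters at $2m$ and $2m+1$ are always opposite, so an equal pair straddles two such blocks.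
-/
theorem odd_of_thueMorse_eq_succ {n : ℕ} (h : thueMorse n = thueMorse (n + 1)) : n % 2 = 1 := by
  by_contra hn
  obtain ⟨m, rfl⟩ : ∃ m, n = 2 * m := ⟨n / 2, by omega⟩
  rw [thueMorse_two_mul, thueMorse_two_mul_add_one] at h
  simp at h

theorem not_thueMorse_cube (n : ℕ) :
    ¬ (thueMorse n = thueMorse (n + 1) ∧ thueMorse (n + 1) = thueMorse (n + 2)) := by
  rintro ⟨h₁, h₂⟩
  have := odd_of_thueMorse_eq_succ h₁
  have := odd_of_thueMorse_eq_succ h₂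
  omega

/-- Among five consecutive letters of the Thue–Morse word two neighbours are equal. -/
theorem exists_thueMorse_eq_succ (n : ℕ) :
    ∃ j < 4, thueMorse (n + j) = thueMorse (n + j + 1) := by
  by_contra! h
  -- Over two letters, unequal neighbours alternate. Then the letters at $n, n+2, n+4$ agree, and
  -- halving the indices yields a cube.
  have key : ∀ j < 3, thueMorse (n + j) = thueMorse (n + j + 2) := by
    intro j hj
    have h₁ := h j (by omega)
    have h₂ := h (j + 1) (by omega)
    rw [show n + (j + 1) = n + j + 1 by ring] at h₂
    revert h₁ h₂
    generalize thueMorse (n + j) = a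
    generalize thueMorse (n + j + 1) = b
    rw [show n + j + 1 + 1 = n + j + 2 by ring]
    generalize thueMorse (n + j + 2) = c
    revert a b c
    decide
  have k₀ := key 0 (by omega)
  have k₂ := key 2 (by omega)
  rcases Nat.even_or_odd' n with ⟨m, rfl | rfl⟩
  · apply not_thueMorse_cube m
    rw [show 2 * m + 0 = 2 * m by ring, show 2 * m + 2 = 2 * (m + 1) by ring] at k₀
    rw [show 2 * m + 2 = 2 * (m + 1) by ring, show 2 * (m + 1) + 2 = 2 * (m + 2) by ring] at k₂
    simpa only [thueMorse_two_mul] using And.intro k₀ k₂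
  · apply not_thueMorse_cube m
    rw [show 2 * m + 1 + 0 = 2 * m + 1 by ring,
      show 2 * m + 1 + 2 = 2 * (m + 1) + 1 by ring] at k₀
    rw [show 2 * m + 1 + 2 = 2 * (m + 1) + 1 by ring,
      show 2 * (m + 1) + 1 + 2 = 2 * (m + 2) + 1 by ring] at k₂
    simpa only [thueMorse_two_mul_add_one, Bool.not_inj_iff] using And.intro k₀ k₂

/-- The Thue–Morse word is overlap-free. -/
theorem thueMorse_overlapFree (p : ℕ) (hp : 0 < p) (i : ℕ) :
    ¬ ∀ j ≤ p, thueMorse (i + j) = thueMorse (i + j + p) := by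
  induction p using Nat.strong_induction_on generalizing i with
  | _ p ih =>
    intro h
    -- An equal pair and its copy at distance $p$ both start at odd indices, so $p$ is even.
    have pair : ∀ j < p, thueMorse (i + j) = thueMorse (i + j + 1) → p % 2 = 0 := by
      intro j hj hij
      have h₁ := odd_of_thueMorse_eq_succ hij
      have h₂ := h j hj.le
      have h₃ := h (j + 1) hj
      rw [show i + (j + 1) = i + j + 1 by ring, show i + j + 1 + p = i + j + p + 1 by ring] at h₃
      have h₄ := odd_of_thueMorse_eq_succ (h₂.symm.trans (hij.trans h₃))
      omega
    have heven : p % 2 = 0 := by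
      rcases Nat.lt_or_ge p 4 with hp4 | hp4
      · interval_cases p
        · exact pair 0 (by omega) (h 0 (by omega))
        · rfl
        -- For $p=3$: without an equal pair, four alternating letters would have different ends,
        -- against the period 3.
        · have h₀ := h 0 (by omega)
          by_contra hne
          have n₀ : ¬ _ := fun e => hne (pair 0 (by omega) e)
          have n₁ : ¬ _ := fun e => hne (pair 1 (by omega) e)
          have n₂ : ¬ _ := fun e => hne (pair 2 (by omega) e)
          simp only [add_zero, add_assoc, Nat.reduceAdd] at h₀ n₀ n₁ n₂
          revert h₀ n₀ n₁ n₂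
          generalize thueMorse i = a
          generalize thueMorse (i + 1) = b
          generalize thueMorse (i + 2) = c
          generalize thueMorse (i + 3) = d
          revert a b c d
          decide
      · obtain ⟨j, hj, e⟩ := exists_thueMorse_eq_succ i
        exact pair j (by omega) e
    -- An overlap of even period descends to one of half the period by halving the indices.
    obtain ⟨q, rfl⟩ : ∃ q, p = 2 * q := ⟨p / 2, by omega⟩
    rcases Nat.even_or_odd' i with ⟨m, rfl | rfl⟩
    · refine ih q (by omega) (by omega) m fun j hj => ?_
      have := h (2 * j) (by omega)
      rwa [← mul_add, ← mul_add, thueMorse_two_mul, thueMorse_two_mul] at this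
    · refine ih q (by omega) (by omega) m fun j hj => ?_
      rcases j with _ | j
      · have := h 0 (by omega)
        rw [show 2 * m + 1 + 0 + 2 * q = 2 * (m + q) + 1 by ring, add_zero,
          thueMorse_two_mul_add_one, thueMorse_two_mul_add_one] at this
        simpa using this
      · have := h (2 * j + 1) (by omega)
        rwa [show 2 * m + 1 + (2 * j + 1) = 2 * (m + (j + 1)) by ring, ← mul_add,
          thueMorse_two_mul, thueMorse_two_mul] at this

/-! ### Square-free words on three and four letters -/

/-- A sequence on the integers contains no square. -/
def NoSquare {A : Type*} (w : ℤ → A) : Prop :=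
  ∀ (i : ℤ) (p : ℕ), 0 < p → ∃ j < p, w (i + j) ≠ w (i + j + p)

/-- There is a square-free infinite word over three letters. -/
theorem exists_squareFree_ternary_nat :
    ∃ h : ℕ → Fin 3, ∀ i p : ℕ, 0 < p → ∃ j < p, h (i + j) ≠ h (i + j + p) := by
  let t : ℕ → ℤ := fun n => if thueMorse n then 1 else 0
  have ht : ∀ n, 0 ≤ t n ∧ t n ≤ 1 := fun n => by simp only [t]; split_ifs <;> simp
  have tinj : ∀ m n, t m = t n → thueMorse m = thueMorse n := by
    intro m n
    simp only [t]
    cases thueMorse m <;> cases thueMorse n <;> simp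
  refine ⟨fun n => if t (n + 1) - t n = 0 then 0 else if t (n + 1) - t n = 1 then 1 else 2, ?_⟩
  intro i p hp
  by_contra! hsq
  have hd : ∀ j < p, t (i + j + 1) - t (i + j) = t (i + j + p + 1) - t (i + j + p) := by
    intro j hj
    have := hsq j hj
    have a₁ := ht (i + j)
    have a₂ := ht (i + j + 1)
    have a₃ := ht (i + j + p)
    have a₄ := ht (i + j + p + 1)
    split_ifs at this <;> omega
  have hshift : ∀ j ≤ p, t (i + j) - t i = t (i + j + p) - t (i + p) := by
    intro j
    induction j with
    | zero => simp
    | succ j ih =>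
      intro hj
      have h₁ := ih (by omega)
      have h₂ := hd j (by omega)
      rw [show i + (j + 1) + p = i + j + p + 1 by ring, ← add_assoc i j 1]
      linarith
  -- The values of `t` at $i, i+p, i+2p$ form an arithmetic progression in $\{0,1\}$, so they are
  -- equal. The shift is then 0 and the square of differences becomes an overlap of Thue–Morse.
  have hend := hshift p le_rfl
  have b₁ := ht i
  have b₂ := ht (i + p)
  have b₃ := ht (i + p + p)
  refine thueMorse_overlapFree p hp i fun j hj => tinj _ _ ?_
  have := hshift j hj
  omega

/-- There is a square-free doubly infinite word over three letters. -/
theorem exists_noSquare_fin_three : ∃ g : ℤ → Fin 3, NoSquare g := by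
  obtain ⟨h, hh⟩ := exists_squareFree_ternary_nat
  -- Compactness: `g` is the limit of the shifts of `h` along a nonprincipal ultrafilter, so each
  -- finite factor of `g` occurs in `h`.
  let U : Ultrafilter ℕ := Filter.hyperfilter ℕ
  have hlim : ∀ i : ℤ, ∃ a : Fin 3, ∀ᶠ N : ℕ in (U : Filter ℕ), h (i + N).toNat = a := by
    intro i
    by_contra! hne
    have : ∀ᶠ N : ℕ in (U : Filter ℕ), ∀ a : Fin 3, h (i + N).toNat ≠ a :=
      Filter.eventually_all.2 fun a => hne a
    obtain ⟨N, hN⟩ := this.exists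
    exact hN _ rfl
  choose g hg using hlim
  refine ⟨g, fun i p hp => ?_⟩
  by_contra! hsq
  have hle : (U : Filter ℕ) ≤ Filter.atTop := by
    rw [← Nat.cofinite_eq_atTop]
    exact Filter.hyperfilter_le_cofinite
  -- For such `N` the truncation in `toNat` has no effect.
  have h₁ : ∀ᶠ N : ℕ in (U : Filter ℕ), i.natAbs ≤ N := hle (Filter.eventually_ge_atTop _)
  have h₂ : ∀ᶠ N : ℕ in (U : Filter ℕ), ∀ j ∈ Finset.range p,
      h (i + j + N).toNat = g (i + j) ∧ h (i + j + p + N).toNat = g (i + j + p) :=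
    (Filter.eventually_all_finset _).2 fun j _ => (hg _).and (hg _)
  obtain ⟨N, hN₁, hN₂⟩ := (h₁.and h₂).exists
  obtain ⟨j, hj, hne⟩ := hh (i + N).toNat p hp
  obtain ⟨e₁, e₂⟩ := hN₂ j (Finset.mem_range.2 hj)
  apply hne
  rw [show (i + N).toNat + j = (i + j + N).toNat by omega,
    show (i + j + N).toNat + p = (i + j + p + N).toNat by omega, e₁, e₂]
  exact hsq j hj

theorem NoSquare.ne_succ {A : Type*} {w : ℤ → A} (h : NoSquare w) (i : ℤ) : w i ≠ w (i + 1) := by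
  obtain ⟨j, hj, hne⟩ := h i 1 one_pos
  obtain rfl : j = 0 := by omega
  simpa using hne

/-- Inserting a fourth letter after every two letters of a square-free ternary word gives a
square-free doubly infinite word over four letters that contains no palindrome of length three. -/
theorem exists_noSquare_palindromeFree :
    ∃ f : ℤ → Fin 4, NoSquare f ∧ ∀ i, f i ≠ f (i + 2) := by
  obtain ⟨g, hg⟩ := exists_noSquare_fin_three
  -- The fourth letter sits at the multiples of 3; $3a+1$ and $3a+2$ carry the letters of `g` of
  -- ranks $2a+1$ and $2a+2$.
  let f : ℤ → Fin 4 := fun i =>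
    if i % 3 = 0 then 3 else (g (2 * (i / 3) + i % 3)).castSucc
  have f0 : ∀ i, f i = 3 ↔ i % 3 = 0 := by
    intro i
    simp only [f]
    split_ifs with h
    · simp [h]
    · simp only [h, iff_false]
      exact (Fin.castSucc_lt_last _).ne
  have f1 : ∀ i, i % 3 ≠ 0 → f i = (g (2 * (i / 3) + i % 3)).castSucc := fun i hi => if_neg hi
  have fg : ∀ i k, i % 3 ≠ 0 → k % 3 ≠ 0 → f i = f k →
      g (2 * (i / 3) + i % 3) = g (2 * (k / 3) + k % 3) := by
    intro i k hi hk h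
    rw [f1 i hi, f1 k hk] at h
    exact Fin.castSucc_injective _ h
  have gne : ∀ i, g i ≠ g (i + 1) := hg.ne_succ
  refine ⟨f, ?_, ?_⟩
  · intro i p hp
    by_contra! hsq
    have hmod : ∀ j < p, (i + j) % 3 = 0 ↔ (i + j + p) % 3 = 0 := by
      intro j hj
      rw [← f0, ← f0, hsq j hj]
    by_cases hp3 : p % 3 = 0
    · obtain ⟨q, rfl⟩ : ∃ q, p = 3 * q := ⟨p / 3, by omega⟩
      -- the first index of the square that does not carry the fourth letter, and its rank
      let r : ℤ := 2 * (i / 3) + if i % 3 = 2 then 2 else 1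
      obtain ⟨s, hs, hne⟩ := hg r (2 * q) (by omega)
      apply hne
      have hr : r + s = 2 * (i / 3) + (if i % 3 = 2 then 2 else 1) + s := rfl
      -- `k` is the index in `f` of the letter of `g` with rank `r + s`.
      let k : ℤ := 3 * ((r + s - 1) / 2) + (r + s - 1) % 2 + 1
      have hk : k = 3 * ((r + s - 1) / 2) + (r + s - 1) % 2 + 1 := rfl
      have hk₁ : i ≤ k ∧ k < i + 3 * q := by split_ifs at hr <;> omega
      have := hsq (k - i).toNat (by omega)
      rw [show i + ((k - i).toNat : ℤ) = k by omega] at this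
      have := fg _ _ (by omega) (by omega) this
      rw [show 2 * (k / 3) + k % 3 = r + s by omega] at this
      rw [this]
      congr 1
      omega
    · rcases Nat.lt_or_ge p 3 with hp' | hp'
      · have h₀ := hmod 0 (by omega)
        interval_cases p
        · have := hsq 0 (by omega)
          simp only [Nat.cast_zero, add_zero, Nat.cast_one] at this h₀
          have := fg _ _ (by omega) (by omega) this
          apply gne (2 * (i / 3) + i % 3)
          rw [this]
          congr 1
          omega
        · have h₁ := hmod 1 (by omega)
          push_cast at h₀ h₁
          omega
      · have h₀ := hmod 0 (by omega)
        have h₁ := hmod 1 (by omega)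
        have h₂ := hmod 2 (by omega)
        push_cast at h₀ h₁ h₂
        omega
  -- Neither index can be a multiple of 3, so they surround one, and their ranks in `g` are
  -- consecutive.
  · intro i h
    have h₀ : i % 3 = 0 ↔ (i + 2) % 3 = 0 := by rw [← f0, ← f0, h]
    have := fg _ _ (by omega) (by omega) h
    apply gne (2 * (i / 3) + i % 3)
    rw [this]
    congr 1
    omega

/-! ### Lazy walks -/

/-- A discrete intermediate value property for lazy walks on the integers. -/
theorem exists_eq_of_lazyWalk (l : ℕ → ℤ) (n : ℕ)
    (hl : ∀ i < n, |l (i + 1) - l i| ≤ 1) (x : ℤ)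
    (hx : (l 0 ≤ x ∧ x ≤ l n) ∨ (l n ≤ x ∧ x ≤ l 0)) : ∃ i ≤ n, l i = x := by
  induction n with
  | zero => exact ⟨0, le_rfl, by omega⟩
  | succ n ih =>
    by_cases h : l (n + 1) = x
    · exact ⟨n + 1, le_rfl, h⟩
    · have := abs_le.1 (hl n (by omega))
      obtain ⟨i, hi, e⟩ := ih (fun i hi => hl i (by omega)) (by omega)
      exact ⟨i, by omega, e⟩

/-- Let `f` be a word on the integers whose factors of length three have distinct letters. If two
lazy walks see the same letters of `f`, then each is the image of the other under a translation or
a reflection of the integers. -/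
theorem lazyWalk_affine {A : Type*} (f : ℤ → A) (h1 : ∀ i, f i ≠ f (i + 1))
    (h2 : ∀ i, f i ≠ f (i + 2)) (a b : ℕ → ℤ) (n : ℕ)
    (ha : ∀ i < n, |a (i + 1) - a i| ≤ 1) (hb : ∀ i < n, |b (i + 1) - b i| ≤ 1)
    (hab : ∀ i ≤ n, f (a i) = f (b i)) :
    ∃ ε : ℤ, (ε = 1 ∨ ε = -1) ∧ ∀ i ≤ n, b i = b 0 + ε * (a i - a 0) := by
  have near : ∀ x y : ℤ, |y - x| ≤ 2 → f x = f y → x = y := by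
    intro x y hxy hf
    have := abs_le.1 hxy
    obtain rfl | rfl | rfl | rfl | rfl :
        y = x ∨ y = x + 1 ∨ y = x + 2 ∨ x = y + 1 ∨ x = y + 2 := by omega
    · rfl
    · exact absurd hf (h1 _)
    · exact absurd hf (h2 _)
    · exact absurd hf.symm (h1 _)
    · exact absurd hf.symm (h2 _)
  -- The induction also carries a pair of corresponding neighbours with the same letter, namely
  -- where the walks last came from. Three consecutive letters are distinct, so this pair determines
  -- the direction of the next step.
  suffices H : (∀ i ≤ n, a i = a 0 ∧ b i = b 0) ∨ ∃ ε : ℤ, (ε = 1 ∨ ε = -1) ∧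
      (∀ i ≤ n, b i = b 0 + ε * (a i - a 0)) ∧
      (f (a n + 1) = f (b n + ε) ∨ f (a n - 1) = f (b n - ε)) by
    rcases H with H | ⟨ε, hε, H, -⟩
    · exact ⟨1, Or.inl rfl, fun i hi => by obtain ⟨e₁, e₂⟩ := H i hi; rw [e₁, e₂]; ring⟩
    · exact ⟨ε, hε, H⟩
  induction n with
  | zero =>
    left
    intro i hi
    obtain rfl : i = 0 := by omega
    simp
  | succ n ih =>
    have hA := abs_le.1 (ha n (by omega))
    have hB := abs_le.1 (hb n (by omega))
    have e₀ := hab n (by omega)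
    have e₁ := hab (n + 1) le_rfl
    have stay : a (n + 1) = a n ↔ b (n + 1) = b n := by
      constructor <;> intro h
      · exact near _ _ (abs_le.2 (by omega)) (by rw [← e₁, h, e₀])
      · exact near _ _ (abs_le.2 (by omega)) (by rw [e₁, h, e₀])
    have split : ∀ {P : ℕ → Prop}, (∀ i ≤ n, P i) → P (n + 1) → ∀ i ≤ n + 1, P i := by
      intro P h h' i hi
      rcases Nat.lt_or_ge n i with hi' | hi'
      · obtain rfl : i = n + 1 := by omega
        exact h'
      · exact h i hi'
    rcases ih (fun i hi => ha i (by omega)) (fun i hi => hb i (by omega))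
      (fun i hi => hab i (by omega)) with H | ⟨ε, hε, H, hloc⟩
    · obtain ⟨a₀, b₀⟩ := H n le_rfl
      by_cases hs : a (n + 1) = a n
      · exact Or.inl (split H ⟨by omega, by omega⟩)
      · right
        have hs' := mt stay.2 hs
        refine ⟨(b (n + 1) - b n) * (a (n + 1) - a n), ?_, split (fun i hi => ?_) ?_, ?_⟩
        · obtain h | h : a (n + 1) - a n = 1 ∨ a (n + 1) - a n = -1 := by omega
          all_goals obtain h' | h' : b (n + 1) - b n = 1 ∨ b (n + 1) - b n = -1 := by omega
          all_goals simp [h, h']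
        · obtain ⟨e₁, e₂⟩ := H i hi
          rw [e₁, e₂]
          ring
        · obtain h | h : a (n + 1) - a n = 1 ∨ a (n + 1) - a n = -1 := by omega
          all_goals rw [← a₀, h]; linarith
        · obtain h | h : a (n + 1) - a n = 1 ∨ a (n + 1) - a n = -1 := by omega
          · right
            rw [h, show a (n + 1) - 1 = a n by omega, e₀]
            congr 1
            ring
          · left
            rw [h, show a (n + 1) + 1 = a n by omega, e₀]
            congr 1
            ring
    · right
      have Hn := H n le_rfl
      have hmove : b (n + 1) - b n = ε * (a (n + 1) - a n) := by
        obtain h | h | h : a (n + 1) = a n ∨ a (n + 1) = a n + 1 ∨ a (n + 1) = a n - 1 := by omega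
        · rw [stay.1 h, h]; ring
        · have hs' := mt stay.2 (by omega : ¬ a (n + 1) = a n)
          rcases hloc with hloc | hloc
          · have := near (b (n + 1)) (b n + ε) (abs_le.2 (by omega)) (by rw [← e₁, h, hloc])
            rw [h, this]; ring
          · by_contra hne
            have hb' : b (n + 1) = b n - ε := by
              rw [h] at hne
              rcases hε with rfl | rfl <;> omega
            have := near (a (n + 1)) (a n - 1) (abs_le.2 (by omega)) (by rw [e₁, hb', hloc])
            omega
        · have hs' := mt stay.2 (by omega : ¬ a (n + 1) = a n)
          rcases hloc with hloc | hloc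
          · by_contra hne
            have hb' : b (n + 1) = b n + ε := by
              rw [h] at hne
              rcases hε with rfl | rfl <;> omega
            have := near (a (n + 1)) (a n + 1) (abs_le.2 (by omega)) (by rw [e₁, hb', hloc])
            omega
          · have := near (b (n + 1)) (b n - ε) (abs_le.2 (by omega)) (by rw [← e₁, h, hloc])
            rw [h, this]; ring
      refine ⟨ε, hε, split H (by linear_combination hmove + Hn), ?_⟩
      obtain h | h | h : a (n + 1) = a n ∨ a (n + 1) = a n + 1 ∨ a (n + 1) = a n - 1 := by omega
      · rwa [h, stay.1 h]
      · right
        rw [h] at hmove ⊢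
        rw [show b (n + 1) = b n + ε by linear_combination hmove]
        simpa using e₀
      · left
        rw [h] at hmove ⊢
        rw [show b (n + 1) = b n - ε by linear_combination hmove]
        simpa using e₀

/-- If a lazy walk reads a square in a square-free word without palindromes of length three, then
its two halves coincide. -/
theorem lazyWalk_boring {A : Type*} (f : ℤ → A) (hf : NoSquare f)
    (h2 : ∀ i, f i ≠ f (i + 2)) (l : ℕ → ℤ) (t : ℕ)
    (hl : ∀ i, i + 1 < 2 * t → |l (i + 1) - l i| ≤ 1)
    (hsq : ∀ i < t, f (l i) = f (l (i + t))) : ∀ i < t, l i = l (i + t) := by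
  rcases t with _ | n
  · simp
  have h1 := hf.ne_succ
  obtain ⟨ε, hε, H⟩ := lazyWalk_affine f h1 h2 l (fun i => l (i + (n + 1))) n
    (fun i hi => hl i (by omega))
    (fun i hi => by
      have := hl (i + (n + 1)) (by omega)
      rwa [show i + (n + 1) + 1 = i + 1 + (n + 1) by ring] at this)
    (fun i hi => hsq i (by omega))
  simp only [zero_add] at H
  have hstep := abs_le.1 (hl n (by omega))
  have visit : ∀ x, ((l 0 ≤ x ∧ x ≤ l n) ∨ (l n ≤ x ∧ x ≤ l 0)) →
      f x = f (l (n + 1) + ε * (x - l 0)) := by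
    intro x hx
    obtain ⟨i, hi, rfl⟩ := exists_eq_of_lazyWalk l n (fun i hi => hl i (by omega)) x hx
    rw [← H i hi]
    exact hsq i (by omega)
  -- The first half covers all positions from `l 0` to within one of `l (n + 1)`. If these differ, a
  -- translation ($\varepsilon=1$) exhibits a square in `f`, and a reflection ($\varepsilon=-1$)
  -- exhibits a palindrome of length three or two about its centre.
  have h0 : l (n + 1) = l 0 := by
    by_contra hne
    rcases hε with rfl | rfl
    · rcases lt_or_gt_of_ne hne with hlt | hlt
      · obtain ⟨j, hj, hj'⟩ := hf (2 * l (n + 1) - l 0 + 1) (l 0 - l (n + 1)).toNat (by omega)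
        apply hj'
        rw [visit (2 * l (n + 1) - l 0 + 1 + j + (l 0 - l (n + 1)).toNat) (by omega)]
        congr 1
        omega
      · obtain ⟨j, hj, hj'⟩ := hf (l 0) (l (n + 1) - l 0).toNat (by omega)
        apply hj'
        rw [visit (l 0 + j) (by omega)]
        congr 1
        omega
    · obtain ⟨m, hm | hm⟩ := Int.even_or_odd' (l (n + 1) + l 0)
      · rcases lt_or_gt_of_ne hne with hlt | hlt
        · apply h2 (m - 1)
          rw [visit (m - 1 + 2) (by omega)]
          congr 1
          omega
        · apply h2 (m - 1)
          rw [visit (m - 1) (by omega)]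
          congr 1
          omega
      · rcases lt_or_gt_of_ne hne with hlt | hlt
        · apply h1 m
          rw [visit (m + 1) (by omega)]
          congr 1
          omega
        · apply h1 m
          rw [visit m (by omega)]
          congr 1
          omega
  have same : ∀ i ≤ n, l i = l (i + (n + 1)) := by
    intro i
    induction i with
    | zero => intro _; simp [h0]
    | succ i ih =>
      intro hi
      have e := ih (by omega)
      have h₁ := abs_le.1 (hl i (by omega))
      have h₂ := abs_le.1 (hl (i + (n + 1)) (by omega))
      have h₃ := hsq (i + 1) (by omega)
      rw [show i + (n + 1) + 1 = i + 1 + (n + 1) by ring] at h₂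
      by_contra hne
      obtain h | h | h | h : l (i + 1 + (n + 1)) = l (i + 1) + 1 ∨
        l (i + 1 + (n + 1)) = l (i + 1) + 2 ∨ l (i + 1) = l (i + 1 + (n + 1)) + 1 ∨
        l (i + 1) = l (i + 1 + (n + 1)) + 2 := by omega
      · exact h1 _ (h ▸ h₃)
      · exact h2 _ (h ▸ h₃)
      · exact h1 _ (h ▸ h₃.symm)
      · exact h2 _ (h ▸ h₃.symm)
  exact fun i hi => same i (by omega)

/-! ### Dyadic rationals and non-crossing edges -/

namespace DyadicRat

/-- The dyadic rational `a / 2 ^ n`. -/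
def mk (n : ℕ) (a : ℤ) : DyadicRat := ⟨(a : ℚ) / 2 ^ n, a, n, rfl⟩

theorem exists_mk (z : DyadicRat) : ∃ n a, z = mk n a := by
  obtain ⟨q, a, n, rfl⟩ := z
  exact ⟨n, a, rfl⟩

theorem mk_lt_mk {m n : ℕ} {a b : ℤ} : (mk m a).1 < (mk n b).1 ↔ a * 2 ^ n < b * 2 ^ m := by
  simp only [mk]
  rw [div_lt_div_iff₀ (by positivity) (by positivity)]
  exact_mod_cast Iff.rfl

theorem mk_le_mk {m n : ℕ} {a b : ℤ} : (mk m a).1 ≤ (mk n b).1 ↔ a * 2 ^ n ≤ b * 2 ^ m := by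
  rw [← not_lt, mk_lt_mk, not_lt]

theorem mk_lt_mk_same {n : ℕ} {a b : ℤ} : (mk n a).1 < (mk n b).1 ↔ a < b := by
  rw [mk_lt_mk, mul_lt_mul_iff_left₀ (by positivity)]

theorem mk_le_mk_same {n : ℕ} {a b : ℤ} : (mk n a).1 ≤ (mk n b).1 ↔ a ≤ b := by
  rw [← not_lt, mk_lt_mk_same, not_lt]

theorem mk_add (n d : ℕ) (a : ℤ) : mk (n + d) (a * 2 ^ d) = mk n a := by
  apply Subtype.ext
  simp only [mk]
  push_cast
  rw [pow_add]
  field_simp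

theorem mk_succ (n : ℕ) (a : ℤ) : mk (n + 1) (2 * a) = mk n a := by
  simpa [mul_comm] using mk_add n 1 a

/-- `x` and `y` are consecutive multiples of some `1 / 2 ^ n`. -/
def Edge (x y : DyadicRat) : Prop := ∃ n b, x = mk n b ∧ y = mk n (b + 1)

theorem Edge.lt {x y : DyadicRat} (h : Edge x y) : x.1 < y.1 := by
  obtain ⟨n, b, rfl, rfl⟩ := h
  rw [mk_lt_mk_same]
  omega

theorem Edge.of_dyadicEdge {x y : DyadicRat} {m : ℤ} (h : DyadicEdge (x.1 - m) (y.1 - m)) :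
    Edge x y := by
  obtain ⟨n, a, -, hx, hy⟩ := h
  refine ⟨n, a + m * 2 ^ n, Subtype.ext ?_, Subtype.ext ?_⟩
  · rw [sub_eq_iff_eq_add] at hx
    rw [hx]
    simp only [mk]
    push_cast
    field_simp
  · rw [sub_eq_iff_eq_add] at hy
    rw [hy]
    simp only [mk]
    push_cast
    field_simp
    ring

theorem Edge.adj {x y : DyadicRat} (h : Edge x y) : lineDyadicGraph.Adj x y := by
  rw [lineDyadicGraph, SimpleGraph.fromRel_adj]
  refine ⟨fun e => h.lt.ne (congrArg _ e), Or.inl ?_⟩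
  obtain ⟨n, b, rfl, rfl⟩ := h
  have hpos : (0 : ℤ) < 2 ^ n := by positivity
  have h₀ := Int.emod_nonneg b hpos.ne'
  have h₁ := Int.emod_lt_of_pos b hpos
  have h₂ := Int.emod_add_mul_ediv b (2 ^ n)
  have hq : (b : ℚ) = ((b % 2 ^ n).toNat : ℚ) + 2 ^ n * ((b / 2 ^ n : ℤ) : ℚ) := by
    have : ((b % 2 ^ n).toNat : ℤ) + 2 ^ n * (b / 2 ^ n) = b := by
      rw [Int.toNat_of_nonneg h₀, h₂]
    exact_mod_cast this.symm
  -- The floor of $b/2^n$ selects the copy of $D$, and the remainder is the index within it.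
  refine ⟨b / 2 ^ n, n, (b % 2 ^ n).toNat, ?_, ?_, ?_⟩
  · zify
    rwa [Int.toNat_of_nonneg h₀]
  · simp only [mk]
    rw [hq]
    field_simp
    ring
  · simp only [mk]
    push_cast
    rw [hq]
    field_simp
    ring

theorem edge_or_edge_of_adj {x y : DyadicRat} (h : lineDyadicGraph.Adj x y) :
    Edge x y ∨ Edge y x := by
  rw [lineDyadicGraph, SimpleGraph.fromRel_adj] at h
  obtain ⟨-, ⟨m, h⟩ | ⟨m, h⟩⟩ := h
  · exact Or.inl (.of_dyadicEdge h)
  · exact Or.inr (.of_dyadicEdge h)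

/-- Edges do not cross: an edge that leaves an interior point of the edge `X Y` to the right ends
at `Y` or before. -/
theorem Edge.le_right {x y X Y : DyadicRat} (h : Edge x y) (H : Edge X Y) (h₁ : X.1 < x.1)
    (h₂ : x.1 < Y.1) : y.1 ≤ Y.1 := by
  obtain ⟨n, b, rfl, rfl⟩ := h
  obtain ⟨N, B, rfl, rfl⟩ := H
  -- If `X Y` is the coarser edge, its ends are multiples of the finer mesh. Otherwise `x` would be
  -- a multiple of $1/2^N$ strictly between consecutive ones.
  rcases le_total N n with hN | hN
  · obtain ⟨d, rfl⟩ := Nat.exists_eq_add_of_le hN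
    rw [← mk_add N d] at h₂ ⊢
    rw [mk_lt_mk_same] at h₂
    rw [mk_le_mk_same]
    omega
  · obtain ⟨d, rfl⟩ := Nat.exists_eq_add_of_le hN
    rw [← mk_add n d, mk_lt_mk_same] at h₁ h₂
    omega

theorem Edge.le_left {x y X Y : DyadicRat} (h : Edge x y) (H : Edge X Y) (h₁ : X.1 < y.1)
    (h₂ : y.1 < Y.1) : X.1 ≤ x.1 := by
  obtain ⟨n, b, rfl, rfl⟩ := h
  obtain ⟨N, B, rfl, rfl⟩ := H
  rcases le_total N n with hN | hN
  · obtain ⟨d, rfl⟩ := Nat.exists_eq_add_of_le hN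
    rw [← mk_add N d] at h₁ ⊢
    rw [mk_lt_mk_same] at h₁
    rw [mk_le_mk_same]
    omega
  · obtain ⟨d, rfl⟩ := Nat.exists_eq_add_of_le hN
    rw [← mk_add n d, mk_lt_mk_same] at h₁ h₂
    omega

theorem Edge.mem_Icc_of_adj {z u X Y : DyadicRat} (H : Edge X Y) (h₁ : X.1 < z.1)
    (h₂ : z.1 < Y.1) (h : lineDyadicGraph.Adj z u) : X.1 ≤ u.1 ∧ u.1 ≤ Y.1 := by
  rcases edge_or_edge_of_adj h with h | h
  · exact ⟨(h₁.trans h.lt).le, h.le_right H h₁ h₂⟩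
  · exact ⟨h.le_left H h₁ h₂, (h.lt.trans h₂).le⟩

/-! ### Levels and indices -/

/-- The level and index of the midpoint of an edge, in terms of those of its ends. -/
def midCoord (p q : ℤ × ℤ) : ℤ × ℤ :=
  -- Equal levels open a new path at index 0; otherwise the midpoint continues the path of the
  -- higher end, to its left or right.
  if p.1 = q.1 then (p.1 + 1, 0) else if p.1 < q.1 then (q.1, q.2 - 1) else (p.1, p.2 + 1)

/-- The level of `a / 2 ^ n`, that is its distance from the integers in the dyadic graph, together
with its index in the path formed by the vertices of its level under an edge of the level below. -/
def coordAux : ℕ → ℤ → ℤ × ℤ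
  | 0, a => (0, a)
  | n + 1, a =>
    if a % 2 = 0 then coordAux n (a / 2) else midCoord (coordAux n (a / 2)) (coordAux n (a / 2 + 1))

theorem coordAux_two_mul (n : ℕ) (a : ℤ) : coordAux (n + 1) (2 * a) = coordAux n a := by
  rw [coordAux, if_pos (by omega), show 2 * a / 2 = a by omega]

theorem coordAux_two_mul_add_one (n : ℕ) (a : ℤ) :
    coordAux (n + 1) (2 * a + 1) = midCoord (coordAux n a) (coordAux n (a + 1)) := by
  rw [coordAux, if_neg (by omega), show (2 * a + 1) / 2 = a by omega]

theorem coordAux_add (n d : ℕ) (a : ℤ) : coordAux (n + d) (a * 2 ^ d) = coordAux n a := by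
  induction d with
  | zero => simp
  | succ d ih => rw [pow_succ, ← ih, ← coordAux_two_mul (n + d)]; congr 1; ring

/-- The level and the index of a dyadic rational. -/
noncomputable def coord (z : DyadicRat) : ℤ × ℤ :=
  coordAux z.exists_mk.choose z.exists_mk.choose_spec.choose

theorem coord_mk (n : ℕ) (a : ℤ) : coord (mk n a) = coordAux n a := by
  have h := (mk n a).exists_mk.choose_spec.choose_spec
  rw [coord]
  generalize (mk n a).exists_mk.choose_spec.choose = b at h ⊢
  generalize (mk n a).exists_mk.choose = m at h b ⊢
  have h' : a * 2 ^ m = b * 2 ^ n :=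
    le_antisymm (mk_le_mk.1 (by rw [← h])) (mk_le_mk.1 (by rw [← h]))
  rw [← coordAux_add n m, ← coordAux_add m n, h', add_comm]

theorem coordAux_edge (n : ℕ) (a : ℤ) :
    ((coordAux n a).1 = (coordAux n (a + 1)).1 ∧ (coordAux n (a + 1)).2 = (coordAux n a).2 + 1) ∨
      (coordAux n (a + 1)).1 = (coordAux n a).1 + 1 ∨
      (coordAux n a).1 = (coordAux n (a + 1)).1 + 1 := by
  induction n generalizing a with
  | zero => simp [coordAux]
  | succ n ih =>
    rcases Int.even_or_odd' a with ⟨b, rfl | rfl⟩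
    · rw [coordAux_two_mul_add_one, coordAux_two_mul, midCoord]
      have := ih b
      split_ifs with h h' <;> dsimp only <;> omega
    · rw [coordAux_two_mul_add_one, show 2 * b + 1 + 1 = 2 * (b + 1) by ring, coordAux_two_mul,
        midCoord]
      have := ih b
      split_ifs with h h' <;> dsimp only <;> omega

theorem Edge.coord {x y : DyadicRat} (h : Edge x y) :
    (x.coord.1 = y.coord.1 ∧ y.coord.2 = x.coord.2 + 1) ∨
      y.coord.1 = x.coord.1 + 1 ∨ x.coord.1 = y.coord.1 + 1 := by
  obtain ⟨n, b, rfl, rfl⟩ := h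
  simpa only [coord_mk] using coordAux_edge n b

theorem coordAux_mid (n : ℕ) (a : ℤ) : (coordAux (n + 1) (2 * a + 1)).1 =
    min (coordAux n a).1 (coordAux n (a + 1)).1 + 1 := by
  rw [coordAux_two_mul_add_one, midCoord]
  have := coordAux_edge n a
  split_ifs with h h' <;> dsimp only <;> omega

/-- Induction on the refinement: a midpoint lies one level above the lower of its neighbours, and no
vertex on the closed edge is below the minimum. -/
theorem coordAux_interior (n : ℕ) (b : ℤ) (d : ℕ) (a : ℤ) (h₁ : b * 2 ^ d < a)
    (h₂ : a < (b + 1) * 2 ^ d) :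
    min (coordAux n b).1 (coordAux n (b + 1)).1 < (coordAux (n + d) a).1 := by
  induction d generalizing a with
  | zero => simp only [pow_zero] at h₁ h₂; omega
  | succ d ih =>
    have e₁ : b * 2 ^ (d + 1) = 2 * (b * 2 ^ d) := by ring
    have e₂ : (b + 1) * 2 ^ (d + 1) = 2 * ((b + 1) * 2 ^ d) := by ring
    rw [e₁] at h₁
    rw [e₂] at h₂
    have closed : ∀ c, b * 2 ^ d ≤ c → c ≤ (b + 1) * 2 ^ d →
        min (coordAux n b).1 (coordAux n (b + 1)).1 ≤ (coordAux (n + d) c).1 := by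
      intro c hc₁ hc₂
      rcases hc₁.eq_or_lt with rfl | hc₁
      · rw [coordAux_add]; omega
      rcases hc₂.eq_or_lt with rfl | hc₂
      · rw [coordAux_add]; omega
      · exact (ih c hc₁ hc₂).le
    rw [← add_assoc]
    rcases Int.even_or_odd' a with ⟨c, rfl | rfl⟩
    · rw [coordAux_two_mul]
      exact ih c (by omega) (by omega)
    · rw [coordAux_mid]
      have := closed c (by omega) (by omega)
      have := closed (c + 1) (by omega) (by omega)
      omega

/-- A vertex strictly under an edge has a higher level than one of the ends of that edge. -/
theorem Edge.lt_level {x y z : DyadicRat} (h : Edge x y) (h₁ : x.1 < z.1) (h₂ : z.1 < y.1) :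
    min x.coord.1 y.coord.1 < z.coord.1 := by
  obtain ⟨n, b, rfl, rfl⟩ := h
  obtain ⟨m, a, rfl⟩ := z.exists_mk
  rw [← mk_add m n, add_comm m n] at h₁ h₂ ⊢
  rw [← mk_add n m, mk_lt_mk_same] at h₁ h₂
  simpa only [coord_mk] using coordAux_interior n b m _ h₁ h₂

/-- Every vertex of level above `k` lies strictly under an edge with both ends of level `k`. -/
theorem exists_edge_above {k : ℤ} (hk : 0 ≤ k) (z : DyadicRat) (hz : k < z.coord.1) :
    ∃ X Y, Edge X Y ∧ X.coord.1 = k ∧ Y.coord.1 = k ∧ X.1 < z.1 ∧ z.1 < Y.1 := by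
  obtain ⟨n, a, rfl⟩ := z.exists_mk
  induction n generalizing a with
  | zero => rw [coord_mk, coordAux] at hz; dsimp only at hz; omega
  | succ n ih =>
    rcases Int.even_or_odd' a with ⟨b, rfl | rfl⟩
    · rw [mk_succ] at hz ⊢
      exact ih b hz
    · have E : Edge (mk n b) (mk n (b + 1)) := ⟨n, b, rfl, rfl⟩
      have l₁ : (mk n b).1 < (mk (n + 1) (2 * b + 1)).1 := by
        rw [← mk_succ, mk_lt_mk_same]; omega
      have l₂ : (mk (n + 1) (2 * b + 1)).1 < (mk n (b + 1)).1 := by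
        rw [← mk_succ n (b + 1), mk_lt_mk_same]; omega
      -- If an end of the cell around `z` is above level `k`, the edge covering that end covers `z`
      -- too, by non-crossing. Otherwise both ends have level exactly `k`, as `z` is one above their
      -- minimum.
      rcases lt_or_ge k (mk n b).coord.1 with h | h
      · obtain ⟨X, Y, H, hX, hY, h₁, h₂⟩ := ih b h
        exact ⟨X, Y, H, hX, hY, h₁.trans l₁, l₂.trans_le (E.le_right H h₁ h₂)⟩
      rcases lt_or_ge k (mk n (b + 1)).coord.1 with h' | h'
      · obtain ⟨X, Y, H, hX, hY, h₁, h₂⟩ := ih (b + 1) h'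
        exact ⟨X, Y, H, hX, hY, (E.le_left H h₁ h₂).trans_lt l₁, l₂.trans h₂⟩
      · refine ⟨_, _, E, ?_, ?_, l₁, l₂⟩
        all_goals
          rw [coord_mk] at hz h h' ⊢
          rw [coordAux_mid] at hz
          omega

/-! ### Simple paths seen at one level -/

/-- `x < y` are the ends of an edge and have the same level `k`. -/
def LevelEdge (k : ℤ) (x y : DyadicRat) : Prop := Edge x y ∧ x.coord.1 = k ∧ y.coord.1 = k

theorem LevelEdge.index {k : ℤ} {x y : DyadicRat} (h : LevelEdge k x y) :
    y.coord.2 = x.coord.2 + 1 := by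
  obtain ⟨h, hx, hy⟩ := h
  rcases h.coord with h | h | h <;> omega

/-- The nearer of two right neighbours would lie strictly under the edge to the farther one, hence
have level above `k`. -/
theorem LevelEdge.right_unique {k : ℤ} {x y y' : DyadicRat} (h : LevelEdge k x y)
    (h' : LevelEdge k x y') : y = y' := by
  obtain ⟨h, hx, hy⟩ := h
  obtain ⟨h', -, hy'⟩ := h'
  apply Subtype.ext
  by_contra hne
  rcases lt_or_gt_of_ne hne with hlt | hlt
  · have := h'.lt_level h.lt hlt; omega
  · have := h.lt_level h'.lt hlt; omega

theorem LevelEdge.left_unique {k : ℤ} {x x' y : DyadicRat} (h : LevelEdge k x y)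
    (h' : LevelEdge k x' y) : x = x' := by
  obtain ⟨h, hx, hy⟩ := h
  obtain ⟨h', hx', -⟩ := h'
  apply Subtype.ext
  by_contra hne
  rcases lt_or_gt_of_ne hne with hlt | hlt
  · have := h.lt_level hlt h'.lt; omega
  · have := h'.lt_level hlt h.lt; omega

/-- The first vertex of level `k` on a walk that starts strictly under an edge with both ends of
level `k` is one of these ends. -/
theorem head_filter_of_interior {k : ℤ} {X Y : DyadicRat} (H : Edge X Y) (hX : X.coord.1 = k)
    (hY : Y.coord.1 = k) (z : DyadicRat) (L : List DyadicRat)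
    (hL : (z :: L).IsChain lineDyadicGraph.Adj) (hk : ∀ v ∈ z :: L, k ≤ v.coord.1)
    (h₁ : X.1 < z.1) (h₂ : z.1 < Y.1) (w : DyadicRat)
    (hw : w ∈ ((z :: L).filter fun v => v.coord.1 = k).head?) : w = X ∨ w = Y := by
  induction L generalizing z with
  | nil =>
    have := H.lt_level h₁ h₂
    have hz : z.coord.1 ≠ k := by omega
    simp [hz] at hw
  | cons u L ih =>
    have := H.lt_level h₁ h₂
    have hz : z.coord.1 ≠ k := by omega
    rw [List.isChain_cons_cons] at hL
    have hin := H.mem_Icc_of_adj h₁ h₂ hL.1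
    rw [List.filter_cons_of_neg (by simpa using hz)] at hw
    by_cases hu : u.coord.1 = k
    · rw [List.filter_cons_of_pos (by simpa using hu)] at hw
      obtain rfl : u = w := by simpa using hw
      rcases hin.1.eq_or_lt with e | l₁
      · exact Or.inl (Subtype.ext e.symm)
      rcases hin.2.eq_or_lt with e | l₂
      · exact Or.inr (Subtype.ext e)
      · have := H.lt_level l₁ l₂
        omega
    · have n₁ : X.1 ≠ u.1 := fun e => hu (by rw [← hX, Subtype.ext e])
      have n₂ : u.1 ≠ Y.1 := fun e => hu (by rw [← hY, Subtype.ext e])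
      exact ih u hL.2 (fun v hv => hk v (List.mem_cons_of_mem _ hv)) (hin.1.lt_of_ne n₁)
        (hin.2.lt_of_ne n₂) hw

/-- An excursion above level `k` stays under one edge with ends of level `k`: it leaves from one end
and, the path being simple, can only return at the other. -/
theorem levelEdge_head_filter {k : ℤ} (hk₀ : 0 ≤ k) (u : DyadicRat) (L : List DyadicRat)
    (hL : (u :: L).IsChain lineDyadicGraph.Adj) (hk : ∀ v ∈ u :: L, k ≤ v.coord.1)
    (hu : u.coord.1 = k) (hn : (u :: L).Nodup) (w : DyadicRat)
    (hw : w ∈ (L.filter fun v => v.coord.1 = k).head?) : LevelEdge k u w ∨ LevelEdge k w u := by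
  rcases L with _ | ⟨z, L⟩
  · simp at hw
  have huw : u ≠ w := by
    rintro rfl
    exact (List.nodup_cons.1 hn).1 (List.mem_of_mem_filter (List.mem_of_mem_head? hw))
  rw [List.isChain_cons_cons] at hL
  by_cases hz : z.coord.1 = k
  · rw [List.filter_cons_of_pos (by simpa using hz)] at hw
    obtain rfl : z = w := by simpa using hw
    exact (edge_or_edge_of_adj hL.1).imp (⟨·, hu, hz⟩) (⟨·, hz, hu⟩)
  · have hz' : k < z.coord.1 := lt_of_le_of_ne (hk z (by simp)) (Ne.symm hz)
    obtain ⟨X, Y, H, hX, hY, h₁, h₂⟩ := exists_edge_above hk₀ z hz'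
    have hu' : u = X ∨ u = Y := by
      have hin := H.mem_Icc_of_adj h₁ h₂ hL.1.symm
      rcases hin.1.eq_or_lt with e | l₁
      · exact Or.inl (Subtype.ext e.symm)
      rcases hin.2.eq_or_lt with e | l₂
      · exact Or.inr (Subtype.ext e)
      · have := H.lt_level l₁ l₂
        omega
    have hw' := head_filter_of_interior H hX hY z L hL.2
      (fun v hv => hk v (List.mem_cons_of_mem _ hv)) h₁ h₂ w hw
    rcases hu' with rfl | rfl <;> rcases hw' with rfl | rfl
    · exact absurd rfl huw
    · exact Or.inl ⟨H, hX, hY⟩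
    · exact Or.inr ⟨H, hX, hY⟩
    · exact absurd rfl huw

/-- The vertices of level `k` on a simple path without vertices of lower level form a path. -/
theorem isChain_filter_level {k : ℤ} (hk₀ : 0 ≤ k) (L : List DyadicRat)
    (hL : L.IsChain lineDyadicGraph.Adj) (hk : ∀ v ∈ L, k ≤ v.coord.1) (hn : L.Nodup) :
    (L.filter fun v => v.coord.1 = k).IsChain fun x y => LevelEdge k x y ∨ LevelEdge k y x := by
  induction L with
  | nil => simp
  | cons u L ih =>
    have ih' := ih hL.tail (fun v hv => hk v (List.mem_cons_of_mem _ hv)) (List.nodup_cons.1 hn).2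
    by_cases hu : u.coord.1 = k
    · rw [List.filter_cons_of_pos (by simpa using hu)]
      rw [List.isChain_cons]
      exact ⟨fun w hw => levelEdge_head_filter hk₀ u L hL hk hu hn w hw, ih'⟩
    · rwa [List.filter_cons_of_neg (by simpa using hu)]

/-- A simple path of vertices of the same level runs through the indices monotonically. -/
theorem exists_step_of_levelEdge_chain {k : ℤ} (L : List DyadicRat)
    (hL : L.IsChain fun x y => LevelEdge k x y ∨ LevelEdge k y x) (hn : L.Nodup) :
    ∃ ε : ℤ, (ε = 1 ∨ ε = -1) ∧ L.IsChain fun x y => y.coord.2 = x.coord.2 + ε := by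
  suffices H : L.IsChain (LevelEdge k) ∨ L.IsChain fun x y => LevelEdge k y x by
    rcases H with H | H
    · exact ⟨1, Or.inl rfl, H.imp fun x y h => h.index⟩
    · exact ⟨-1, Or.inr rfl, H.imp fun x y h => by rw [h.index]; ring⟩
  induction L with
  | nil => simp
  | cons x L ih =>
    rcases L with _ | ⟨y, L⟩
    · simp
    rcases L with _ | ⟨z, L⟩
    · simpa using hL
    -- Neighbours within a level are unique on each side, so reversing direction would revisit a
    -- vertex.
    have hxz : x ≠ z := by
      rintro rfl
      simp at hn
    rw [List.isChain_cons_cons] at hL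
    rcases ih hL.2 (List.nodup_cons.1 hn).2 with H | H
    · left
      refine List.isChain_cons_cons.2 ⟨hL.1.resolve_right fun h => hxz ?_, H⟩
      exact h.right_unique (List.isChain_cons_cons.1 H).1
    · right
      refine List.isChain_cons_cons.2 ⟨hL.1.resolve_left fun h => hxz ?_, H⟩
      exact h.left_unique (List.isChain_cons_cons.1 H).1

theorem coord_fst_nonneg (z : DyadicRat) : 0 ≤ z.coord.1 := by
  obtain ⟨n, a, rfl⟩ := z.exists_mk
  rw [coord_mk]
  induction n generalizing a with
  | zero => simp [coordAux]
  | succ n ih =>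
    rcases Int.even_or_odd' a with ⟨b, rfl | rfl⟩
    · rw [coordAux_two_mul]; exact ih b
    · rw [coordAux_mid]
      have := ih b
      have := ih (b + 1)
      omega

end DyadicRat

/-! ### The square-free coloring -/

/-- A word on the integers without squares has none when it is read with constant step `±1`. -/
theorem NoSquare.exists_ne_of_step {A : Type*} {w : ℤ → A} (h : NoSquare w) (ε : ℤ)
    (hε : ε = 1 ∨ ε = -1) (i : ℤ) (p : ℕ) (hp : 0 < p) :
    ∃ j < p, w (i + ε * j) ≠ w (i + ε * (j + p : ℕ)) := by
  rcases hε with rfl | rfl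
  · obtain ⟨j, hj, hne⟩ := h i p hp
    refine ⟨j, hj, ?_⟩
    rwa [one_mul, one_mul, Nat.cast_add, ← add_assoc]
  · obtain ⟨j, hj, hne⟩ := h (i - 2 * p + 1) p hp
    refine ⟨p - 1 - j, by omega, ?_⟩
    rw [show i + -1 * ((p - 1 - j : ℕ) : ℤ) = i - 2 * p + 1 + j + p by omega,
      show i + -1 * ((p - 1 - j + p : ℕ) : ℤ) = i - 2 * p + 1 + j by omega]
    exact hne.symm

theorem List.getElem_eq_add_mul_of_isChain {α : Type*} (φ : α → ℤ) (ε : ℤ) (L : List α)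
    (hL : L.IsChain fun x y => φ y = φ x + ε) (h₀ : 0 < L.length) (i : ℕ) (hi : i < L.length) :
    φ L[i] = φ L[0] + ε * i := by
  induction i with
  | zero => simp
  | succ i ih =>
    rw [List.isChain_iff_getElem.1 hL i hi, ih (by omega)]
    push_cast
    ring

namespace DyadicRat

/-- The coloring of the dyadic rationals by a letter depending on the level and a letter depending
on the index. -/
noncomputable def color (f : ℤ → Fin 4) (g : ℤ → Fin 3) (z : DyadicRat) : Fin 12 :=
  finProdFinEquiv (f z.coord.1, g z.coord.2)

theorem color_eq_color {f : ℤ → Fin 4} {g : ℤ → Fin 3} {y z : DyadicRat} :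
    color f g y = color f g z ↔ f y.coord.1 = f z.coord.1 ∧ g y.coord.2 = g z.coord.2 := by
  rw [color, color, finProdFinEquiv.injective.eq_iff, Prod.mk.injEq]

theorem abs_level_sub_le {x y : DyadicRat} (h : lineDyadicGraph.Adj x y) :
    |y.coord.1 - x.coord.1| ≤ 1 := by
  rw [abs_le]
  rcases edge_or_edge_of_adj h with h | h <;> rcases h.coord with h | h | h <;> omega

/-- The two halves of a path that repeats its colors have the same levels. -/
theorem level_eq_of_color_eq {f : ℤ → Fin 4} {g : ℤ → Fin 3} (hf : NoSquare f)
    (hf' : ∀ i, f i ≠ f (i + 2)) (L M : List DyadicRat)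
    (hL : (L ++ M).IsChain lineDyadicGraph.Adj)
    (hc : L.map (color f g) = M.map (color f g)) :
    L.map (fun v => v.coord.1) = M.map fun v => v.coord.1 := by
  have hlen : L.length = M.length := by simpa using congrArg List.length hc
  -- The value 0 beyond the end of the path is never used.
  let l : ℕ → ℤ := fun i => if h : i < (L ++ M).length then (L ++ M)[i].coord.1 else 0
  have hl : ∀ i (h : i < (L ++ M).length), l i = (L ++ M)[i].coord.1 := fun i h => dif_pos h
  have hlL : ∀ i (h : i < L.length), l i = L[i].coord.1 := fun i h => by
    rw [hl i (by rw [List.length_append]; omega), List.getElem_append_left h]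
  have hlM : ∀ i (h : i < M.length), l (i + L.length) = M[i].coord.1 := fun i h => by
    rw [hl _ (by rw [List.length_append]; omega), List.getElem_append_right (by omega)]
    simp
  have key := lazyWalk_boring f hf hf' l L.length ?_ ?_
  · refine List.ext_getElem (by simpa using hlen) fun i h₁ h₂ => ?_
    rw [List.length_map] at h₁ h₂
    rw [List.getElem_map, List.getElem_map, ← hlL i h₁, ← hlM i h₂]
    exact key i h₁
  · intro i hi
    have hi' : i + 1 < (L ++ M).length := by rw [List.length_append]; omega
    rw [hl _ hi', hl i (by omega)]
    exact abs_level_sub_le (List.isChain_iff_getElem.1 hL i hi')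
  · intro i hi
    rw [hlL i hi, hlM i (by omega)]
    have := List.getElem_of_eq hc (i := i) (by simpa using hi)
    rw [List.getElem_map, List.getElem_map, color_eq_color] at this
    exact this.1

/-- Equal color words force equal level words. The vertices of lowest level in the two halves then
give a square of `g`, read forwards or backwards. -/
theorem map_color_ne {f : ℤ → Fin 4} {g : ℤ → Fin 3} (hf : NoSquare f)
    (hf' : ∀ i, f i ≠ f (i + 2)) (hg : NoSquare g) (L M : List DyadicRat)
    (hL : (L ++ M).IsChain lineDyadicGraph.Adj) (hn : (L ++ M).Nodup) (h₀ : L ≠ []) :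
    L.map (color f g) ≠ M.map (color f g) := by
  intro hc
  have hlev := level_eq_of_color_eq hf hf' L M hL hc
  classical
  obtain ⟨v, hv, hmin⟩ : ∃ v ∈ L, ∀ w ∈ L, v.coord.1 ≤ w.coord.1 := by
    obtain ⟨v, hv, hmin⟩ := L.toFinset.exists_min_image (fun v => v.coord.1)
      (List.toFinset_nonempty_iff L |>.2 h₀)
    exact ⟨v, by simpa using hv, by simpa using hmin⟩
  set k := v.coord.1 with hk
  have hmin' : ∀ w ∈ L ++ M, k ≤ w.coord.1 := by
    intro w hw
    rcases List.mem_append.1 hw with hw | hw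
    · exact hmin w hw
    · have : w.coord.1 ∈ M.map fun v => v.coord.1 := List.mem_map_of_mem hw
      rw [← hlev] at this
      obtain ⟨u, hu, e⟩ := List.mem_map.1 this
      exact e ▸ hmin u hu
  have hchain := isChain_filter_level (coord_fst_nonneg v) (L ++ M) hL hmin' hn
  obtain ⟨ε, hε, hstep⟩ := exists_step_of_levelEdge_chain _ hchain (hn.filter _)
  rw [List.filter_append] at hstep
  -- Pairing colors with levels lets the selection of level `k` be made on the words, so the
  -- selected colors still agree.
  have hpair : L.map (fun v => (v.coord.1, color f g v)) =
      M.map fun v => (v.coord.1, color f g v) := by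
    rw [← List.zip_map', ← List.zip_map', hlev, hc]
  have hfilter : (L.filter fun v => v.coord.1 = k).map (color f g) =
      (M.filter fun v => v.coord.1 = k).map (color f g) := by
    have := congrArg (fun l => (l.filter fun p : ℤ × Fin 12 => p.1 = k).map Prod.snd) hpair
    simpa [List.filter_map, Function.comp_def] using this
  have hvF : v ∈ L.filter fun v => v.coord.1 = k := by simp [hv, hk]
  generalize (L.filter fun v => v.coord.1 = k) = F at *
  generalize (M.filter fun v => v.coord.1 = k) = F' at *
  have hlen : F.length = F'.length := by simpa using congrArg List.length hfilter
  have hpos : 0 < F.length := List.length_pos_of_mem hvF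
  have hget := List.getElem_eq_add_mul_of_isChain (fun z => z.coord.2) ε (F ++ F') hstep
    (by rw [List.length_append]; omega)
  obtain ⟨j, hj, hne⟩ := hg.exists_ne_of_step ε hε ((F ++ F')[0]'(by
    rw [List.length_append]; omega)).coord.2 F.length hpos
  apply hne
  rw [← hget j (by rw [List.length_append]; omega),
    ← hget (j + F.length) (by rw [List.length_append]; omega),
    List.getElem_append_left hj, List.getElem_append_right (by omega)]
  have := List.getElem_of_eq hfilter (i := j) (by simpa using hj)
  rw [List.getElem_map, List.getElem_map, color_eq_color] at this
  simpa using this.2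

/-- The word of colors along a simple path is square-free. -/
theorem wordSquareFree_map_color {f : ℤ → Fin 4} {g : ℤ → Fin 3} (hf : NoSquare f)
    (hf' : ∀ i, f i ≠ f (i + 2)) (hg : NoSquare g) (L : List DyadicRat)
    (hL : L.IsChain lineDyadicGraph.Adj) (hn : L.Nodup) :
    WordSquareFree (L.map (color f g)) := by
  rintro ⟨P, X, S, hX, h⟩
  obtain ⟨L₁, S', rfl, h₁, -⟩ := List.map_eq_append_iff.1 h
  obtain ⟨L₂, B, rfl, h₂, hB⟩ := List.map_eq_append_iff.1 h₁
  obtain ⟨P', A, rfl, -, hA⟩ := List.map_eq_append_iff.1 h₂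
  have hsub : A ++ B <:+: P' ++ A ++ B ++ S' := ⟨P', S', by simp⟩
  refine map_color_ne hf hf' hg A B (hL.infix hsub) (hn.sublist hsub.sublist) ?_
    (hA.trans hB.symm)
  rintro rfl
  exact hX hA.symm

end DyadicRat

/-! ### Rightward paths and their subdivisions -/

namespace DyadicRat

/-- The midpoint of two dyadic rationals. -/
def midpoint (x y : DyadicRat) : DyadicRat :=
  ⟨(x.1 + y.1) / 2, by
    obtain ⟨⟨_, a, n, rfl⟩, ⟨_, b, m, rfl⟩⟩ := x, y
    refine ⟨a * 2 ^ m + b * 2 ^ n, n + m + 1, ?_⟩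
    push_cast
    rw [pow_succ, pow_add]
    field_simp⟩

theorem midpoint_mk (n : ℕ) (b : ℤ) :
    midpoint (mk n b) (mk n (b + 1)) = mk (n + 1) (2 * b + 1) := by
  apply Subtype.ext
  simp only [midpoint, mk]
  push_cast
  rw [pow_succ]
  field_simp
  ring

theorem Edge.left_midpoint {x y : DyadicRat} (h : Edge x y) : Edge x (midpoint x y) := by
  obtain ⟨n, b, rfl, rfl⟩ := h
  exact ⟨n + 1, 2 * b, (mk_succ n b).symm, midpoint_mk n b⟩

theorem Edge.midpoint_right {x y : DyadicRat} (h : Edge x y) : Edge (midpoint x y) y := by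
  obtain ⟨n, b, rfl, rfl⟩ := h
  refine ⟨n + 1, 2 * b + 1, midpoint_mk n b, ?_⟩
  rw [← mk_succ]
  congr 1
  ring

/-- Insert the midpoint of the edge that enters the vertex with index `i`. -/
def subdivide (p : ℤ → DyadicRat) (i : ℤ) : ℤ → DyadicRat :=
  extendAt p i (midpoint (p (i - 1)) (p i))

theorem subdivide_edge {p : ℤ → DyadicRat} (hp : ∀ j, Edge (p j) (p (j + 1))) (i j : ℤ) :
    Edge (subdivide p i j) (subdivide p i (j + 1)) := by
  have hi : Edge (p (i - 1)) (p i) := by simpa using hp (i - 1)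
  rcases lt_trichotomy (j + 1) i with h | h | h
  · simpa [subdivide, extendAt, h, show j < i by omega] using hp j
  · obtain rfl : j = i - 1 := by omega
    simpa [subdivide, extendAt] using hi.left_midpoint
  · obtain rfl | h' : j = i ∨ i < j := by omega
    · simpa [subdivide, extendAt] using hi.midpoint_right
    · simpa [subdivide, extendAt, h'.not_gt, h'.ne', h.not_gt, h.ne'] using hp (j - 1)

/-- This turns subdivision of a path into extension of its color word. -/
theorem comp_extendAt {A B : Type*} (c : A → B) (w : ℤ → A) (i : ℤ) (x : A) :
    (fun j => c (extendAt w i x j)) = extendAt (fun j => c (w j)) i (c x) := by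
  funext j
  simp only [extendAt]
  split_ifs <;> rfl

/-- The word of colors along a doubly infinite rightward path is square-free. -/
theorem biSquareFree_of_edge {f : ℤ → Fin 4} {g : ℤ → Fin 3} (hf : NoSquare f)
    (hf' : ∀ i, f i ≠ f (i + 2)) (hg : NoSquare g) {p : ℤ → DyadicRat}
    (hp : ∀ j, Edge (p j) (p (j + 1))) : BiSquareFree fun i => color f g (p i) := by
  intro i n
  have hmono : StrictMono fun j => (p j).1 := strictMono_int_of_lt_succ fun j => (hp j).lt
  have hL := wordSquareFree_map_color hf hf' hg ((List.range n).map fun k : ℕ => p (i + k)) ?_ ?_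
  · rwa [List.map_map] at hL
  · rw [List.isChain_iff_getElem]
    intro k hk
    simp only [List.getElem_map, List.getElem_range]
    have := (hp (i + k)).adj
    rwa [add_assoc] at this
  · refine List.nodup_range.map fun a b hab => ?_
    have := hmono.injective (congrArg Subtype.val hab)
    omega

end DyadicRat

/-! ### The rooted tree of position sequences -/

/-- The vertices of the tree of sequences of positions. -/
structure PositionSeq where
  /-- The sequence of positions that leads from the root to the vertex. -/
  toList : List ℤ

namespace PositionSeq

/-- The longest common prefix of two lists. -/
def commonPrefix : List ℤ → List ℤ → List ℤ
  | a :: l, b :: m => if a = b then a :: commonPrefix l m else []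
  | _, _ => []

theorem prefix_commonPrefix_iff (k l m : List ℤ) :
    k <+: commonPrefix l m ↔ k <+: l ∧ k <+: m := by
  fun_induction commonPrefix l m generalizing k with
  | case1 l b m ih =>
    rcases k with _ | ⟨c, k⟩
    · simp
    · simp only [List.cons_prefix_cons, ih]
      tauto
  | case2 a l b m h =>
    rcases k with _ | ⟨c, k⟩
    · simp
    · simp only [List.cons_prefix_cons, List.prefix_nil, reduceCtorEq, false_iff]
      rintro ⟨⟨rfl, -⟩, rfl, -⟩
      exact h rfl
  | case3 l m h =>
    rcases l with _ | ⟨a, l⟩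
    · simp +contextual
    · rcases m with _ | ⟨b, m⟩
      · simp +contextual
      · exact absurd rfl (h a l b m rfl)

/-- Ancestors are prefixes; the wrapper type keeps this order apart from the lexicographic one on
lists. -/
instance : SemilatticeInf PositionSeq where
  le u v := u.toList <+: v.toList
  le_refl u := List.prefix_rfl
  le_trans _ _ _ h₁ h₂ := h₁.trans h₂
  le_antisymm u v h₁ h₂ := by
    cases u; cases v
    exact congrArg _ (h₁.eq_of_length_le h₂.length_le)
  inf u v := ⟨commonPrefix u.toList v.toList⟩
  inf_le_left u v := ((prefix_commonPrefix_iff _ _ _).1 List.prefix_rfl).1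
  inf_le_right u v := ((prefix_commonPrefix_iff _ _ _).1 List.prefix_rfl).2
  le_inf _ _ _ h₁ h₂ := (prefix_commonPrefix_iff _ _ _).2 ⟨h₁, h₂⟩

theorem le_iff {u v : PositionSeq} : u ≤ v ↔ u.toList <+: v.toList := Iff.rfl

instance : OrderBot PositionSeq where
  bot := ⟨[]⟩
  bot_le _ := List.nil_prefix

/-- The vertex reached from `u` by appending the position `i`. -/
def child (u : PositionSeq) (i : ℤ) : PositionSeq := ⟨u.toList ++ [i]⟩

theorem le_child_iff {u v : PositionSeq} {i : ℤ} : v ≤ u.child i ↔ v = u.child i ∨ v ≤ u := by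
  cases u; cases v
  simp [le_iff, child, List.prefix_concat_iff]

theorem lt_child (u : PositionSeq) (i : ℤ) : u < u.child i := by
  refine lt_of_le_of_ne (le_child_iff.2 (Or.inr le_rfl)) fun h => ?_
  have := congrArg (fun v => v.toList.length) h
  simp [child] at this

theorem eq_bot_or_eq_child (v : PositionSeq) : v = ⊥ ∨ ∃ u i, v = child u i := by
  obtain ⟨l⟩ := v
  rcases l.eq_nil_or_concat' with rfl | ⟨l, i, rfl⟩
  · exact Or.inl rfl
  · exact Or.inr ⟨⟨l⟩, i, rfl⟩

/-- The parent of a vertex. -/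
def parent (v : PositionSeq) : PositionSeq := ⟨v.toList.dropLast⟩

theorem parent_child (u : PositionSeq) (i : ℤ) : (u.child i).parent = u := by
  simp [parent, child]

instance : PredOrder PositionSeq where
  pred := parent
  pred_le v := List.dropLast_prefix _
  min_of_le_pred {v} h := by
    rcases eq_bot_or_eq_child v with rfl | ⟨u, i, rfl⟩
    · exact isMin_bot
    · rw [parent_child] at h
      exact absurd h (lt_child u i).not_ge
  le_pred_of_lt {v w} h := by
    rcases eq_bot_or_eq_child w with rfl | ⟨u, i, rfl⟩
    · exact absurd h not_lt_bot
    · rw [parent_child]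
      exact (le_child_iff.1 h.le).resolve_left h.ne

theorem pred_child (u : PositionSeq) (i : ℤ) : Order.pred (u.child i) = u := parent_child u i

instance : IsPredArchimedean PositionSeq where
  exists_pred_iterate_of_le {v w} h := by
    obtain ⟨l⟩ := w
    induction l using List.reverseRecOn with
    | nil => exact ⟨0, (le_bot_iff.1 h).symm⟩
    | append_singleton l i ih =>
      rcases (le_child_iff (u := ⟨l⟩)).1 h with e | h'
      · exact ⟨0, e.symm⟩
      · obtain ⟨n, hn⟩ := ih h'
        refine ⟨n + 1, ?_⟩
        rw [Function.iterate_succ_apply]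
        exact (congrArg _ (pred_child ⟨l⟩ i)).trans hn

theorem covBy_iff {u v : PositionSeq} : u ⋖ v ↔ ∃ i, v = u.child i := by
  constructor
  · intro h
    rcases eq_bot_or_eq_child v with rfl | ⟨w, i, rfl⟩
    · exact absurd h.lt not_lt_bot
    · have := h.pred_eq
      rw [pred_child] at this
      exact ⟨i, by rw [this]⟩
  · rintro ⟨i, rfl⟩
    refine ⟨lt_child u i, fun w hw hw' => ?_⟩
    exact hw.not_ge ((le_child_iff.1 hw'.le).resolve_left hw'.ne)

/-- The last position of a sequence. -/
def lastPosition (v : PositionSeq) : ℤ := v.toList.getLastD 0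

theorem lastPosition_child (u : PositionSeq) (i : ℤ) : (u.child i).lastPosition = i := by
  simp [lastPosition, child]

/-- The doubly infinite path obtained from the path of the integers by subdividing successively
at the given positions. -/
def path (v : PositionSeq) : ℤ → DyadicRat :=
  v.toList.foldl DyadicRat.subdivide (DyadicRat.mk 0)

theorem path_child (u : PositionSeq) (i : ℤ) : (u.child i).path = DyadicRat.subdivide u.path i := by
  simp [path, child]

theorem path_edge (v : PositionSeq) (j : ℤ) : (v.path j).Edge (v.path (j + 1)) := by
  obtain ⟨l⟩ := v
  induction l using List.reverseRecOn generalizing j with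
  | nil => exact ⟨0, j, rfl, rfl⟩
  | append_singleton l i ih =>
    have := path_child ⟨l⟩ i
    rw [child] at this
    rw [this]
    exact DyadicRat.subdivide_edge ih i j

end PositionSeq

theorem theorem2p6 :
    ∃ c : DyadicRat → Fin 12, IsSquareFreeColoring lineDyadicGraph c ∧
      ∃ (T : RootedTree.{0}) (path : T → ℤ → DyadicRat) (pos : T → ℤ),
        IsCompleteBifurcateTree T (fun v i => c (path v i)) pos ∧
        (∀ v : T, IsRightwardPath (path v)) ∧
        ∀ n : ℤ, (path ⊥ n).1 = (n : ℚ) := by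
  obtain ⟨f, hf, hf'⟩ := exists_noSquare_palindromeFree
  obtain ⟨g, hg⟩ := exists_noSquare_fin_three
  have hfree : ∀ v : PositionSeq, BiSquareFree fun i => DyadicRat.color f g (v.path i) :=
    fun v => DyadicRat.biSquareFree_of_edge hf hf' hg v.path_edge
  have hext : ∀ (u : PositionSeq) (i : ℤ), ∃ x,
      (fun j => DyadicRat.color f g ((u.child i).path j)) =
        extendAt (fun j => DyadicRat.color f g (u.path j)) i x := by
    intro u i
    rw [PositionSeq.path_child]
    exact ⟨_, DyadicRat.comp_extendAt _ _ _ _⟩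
  refine ⟨DyadicRat.color f g, fun u v p hp => ?_, ⟨PositionSeq⟩, PositionSeq.path,
    PositionSeq.lastPosition, ⟨fun v => ⟨hfree v, fun i => ?_⟩, fun u v h => ?_,
      fun u v w hv hw e => ?_, fun u i => ?_⟩, fun v i => ?_, fun n => ?_⟩
  · exact DyadicRat.wordSquareFree_map_color hf hf' hg _ p.isChain_adj_support hp.support_nodup
  -- The word of the child at `i` is itself the required square-free extension.
  · obtain ⟨x, hx⟩ := hext v i
    exact ⟨x, hx ▸ hfree (PositionSeq.child v i)⟩
  · obtain ⟨i, rfl⟩ := PositionSeq.covBy_iff.1 h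
    rw [PositionSeq.lastPosition_child]
    exact hext u i
  · obtain ⟨i, rfl⟩ := PositionSeq.covBy_iff.1 hv
    obtain ⟨j, rfl⟩ := PositionSeq.covBy_iff.1 hw
    rw [PositionSeq.lastPosition_child, PositionSeq.lastPosition_child] at e
    rw [e]
  · exact ⟨PositionSeq.child u i, PositionSeq.covBy_iff.2 ⟨i, rfl⟩,
      PositionSeq.lastPosition_child u i⟩
  · exact ⟨(PositionSeq.path_edge v i).lt, (PositionSeq.path_edge v i).adj⟩
  · change (n : ℚ) / 2 ^ 0 = n
    simp
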